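/- A \emph{$6$-cycle system of order $v$} is a partition of the edge set of the complete graph $K_v$ into (nonempty) subsets, called blocks, each of which is the edge set of a cycle of length $6$. Two $6$-cycle systems $C_1, C_2$ on the same $v$ vertices are \emph{orthogonal} if every block of $C_1$ and every block of $C_2$ have at most one edge in common. For every natural number $v \equiv 1, 9, 13$ or $21 \pmod{24}$ there exists a pair $(C_1, C_2)$ of orthogonal $6$-cycle systems of order $v$ (for $v = 1$ both are the empty system). Moreover these are all the admissible orders: if $v \geq 1$ and a $6$-cycle system of order $v$ exists, then $v \equiv 1, 9, 13$ or $21 \pmod{24}$. -/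

import Mathlib

/-- The edge set `E` (on the vertex set `V`) is that of a copy of `H`: it is the image of the
edge set of `H` under an injective map of vertices. -/
def IsCopyOf {W V : Type*} (H : SimpleGraph W) (E : Set (Sym2 V)) : Prop :=
  ∃ f : W ↪ V, E = Sym2.map f '' H.edgeSet

/-- `𝒟` is an `H`-decomposition of `G`: a partition of the edge set of `G` into nonempty subsets,
each of which is the edge set of a copy of `H`. -/
structure IsDecomposition {W V : Type*} (H : SimpleGraph W) (G : SimpleGraph V)
    (𝒟 : Set (Set (Sym2 V))) : Prop where
  isCopy : ∀ E ∈ 𝒟, IsCopyOf H E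
  nonempty : ∀ E ∈ 𝒟, E.Nonempty
  disjoint : ∀ E ∈ 𝒟, ∀ F ∈ 𝒟, E ≠ F → Disjoint E F
  cover : ⋃₀ 𝒟 = G.edgeSet

/-- Two decompositions are orthogonal if every block of the one and every block of the other
have at most one edge in common. -/
def AreOrthogonal {V : Type*} (𝒞 𝒟 : Set (Set (Sym2 V))) : Prop :=
  ∀ E ∈ 𝒞, ∀ F ∈ 𝒟, (E ∩ F).encard ≤ 1

/-- An `l`-cycle system of order `v` (for `3 ≤ l`): a decomposition of the complete graph on
`v` vertices into cycles of length `l`. -/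
def IsCycleSystem (l v : ℕ) (𝒞 : Set (Set (Sym2 (Fin v)))) : Prop :=
  IsDecomposition (SimpleGraph.cycleGraph l) (⊤ : SimpleGraph (Fin v)) 𝒞

/-! The four residues mod 24 are exactly 1 and 9 mod 12, so existence follows by adding 12 vertices
at a time to order 1 or 9. For v = 4m + 1, K_{v+12} splits into K_v, a K_13 sharing one vertex with
it, and m copies of K_{4,12}. Blocks from different pieces share no edge, so orthogonal pairs on the
pieces unite to one on the whole (`HasOrthogonalPair.iUnion`). Only K_9, K_13 and K_{4,12} need
explicit pairs.

Conversely, 6 divides the number of edges, and every degree v - 1 is even because a cycle uses 0 or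
2 edges at each vertex. -/

/-- The graph `G` has a pair of orthogonal `H`-decompositions. -/
def HasOrthogonalPair {W V : Type*} (H : SimpleGraph W) (G : SimpleGraph V) : Prop :=
  ∃ 𝒞 𝒟 : Set (Set (Sym2 V)),
    IsDecomposition H G 𝒞 ∧ IsDecomposition H G 𝒟 ∧ AreOrthogonal 𝒞 𝒟

/-! ### Transport and edge-disjoint union of decompositions -/

section Constructions

variable {W V V' : Type*} {H : SimpleGraph W}

theorem IsDecomposition.subset_edgeSet {G : SimpleGraph V} {𝒟 : Set (Set (Sym2 V))}
    (h : IsDecomposition H G 𝒟) {E : Set (Sym2 V)} (hE : E ∈ 𝒟) : E ⊆ G.edgeSet :=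
  h.cover ▸ Set.subset_sUnion_of_mem hE

theorem IsCopyOf.map {E : Set (Sym2 V)} (h : IsCopyOf H E) (f : V ↪ V') :
    IsCopyOf H (Sym2.map f '' E) := by
  obtain ⟨g, rfl⟩ := h
  refine ⟨g.trans f, ?_⟩
  rw [Set.image_image]
  refine Set.image_congr fun e _ => ?_
  rw [Sym2.map_map]
  rfl

theorem IsDecomposition.map {G : SimpleGraph V} {𝒟 : Set (Set (Sym2 V))}
    (h : IsDecomposition H G 𝒟) (f : V ↪ V') :
    IsDecomposition H (G.map f) (Set.image (Sym2.map f) '' 𝒟) where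
  isCopy := by
    rintro _ ⟨E, hE, rfl⟩
    exact (h.isCopy E hE).map f
  nonempty := by
    rintro _ ⟨E, hE, rfl⟩
    exact (h.nonempty E hE).image _
  disjoint := by
    rintro _ ⟨E, hE, rfl⟩ _ ⟨F, hF, rfl⟩ hne
    exact (Set.disjoint_image_iff (Sym2.map.injective f.injective)).2
      (h.disjoint E hE F hF fun hEF => hne (by rw [hEF]))
  cover := by
    rw [SimpleGraph.edgeSet_map, ← h.cover, Set.sUnion_image, Set.sUnion_eq_biUnion,
      Set.image_iUnion₂]
    rfl

theorem AreOrthogonal.map {𝒞 𝒟 : Set (Set (Sym2 V))} (h : AreOrthogonal 𝒞 𝒟) (f : V ↪ V') :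
    AreOrthogonal (Set.image (Sym2.map f) '' 𝒞) (Set.image (Sym2.map f) '' 𝒟) := by
  rintro _ ⟨E, hE, rfl⟩ _ ⟨F, hF, rfl⟩
  have hf := Sym2.map.injective f.injective
  rw [← Set.image_inter hf, hf.encard_image]
  exact h E hE F hF

theorem HasOrthogonalPair.map {G : SimpleGraph V} (h : HasOrthogonalPair H G) (f : V ↪ V') :
    HasOrthogonalPair H (G.map f) := by
  obtain ⟨𝒞, 𝒟, h𝒞, h𝒟, hort⟩ := h
  exact ⟨_, _, h𝒞.map f, h𝒟.map f, hort.map f⟩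

theorem HasOrthogonalPair.top_congr (h : HasOrthogonalPair H (⊤ : SimpleGraph V))
    (e : V ≃ V') : HasOrthogonalPair H (⊤ : SimpleGraph V') := by
  have hmap : (⊤ : SimpleGraph V).map e.toEmbedding = ⊤ := by
    ext a b
    simp only [SimpleGraph.map_adj, SimpleGraph.top_adj]
    constructor
    · rintro ⟨u, v, huv, rfl, rfl⟩
      exact e.injective.ne huv
    · exact fun hab => ⟨e.symm a, e.symm b, e.symm.injective.ne hab, by simp, by simp⟩
  exact hmap ▸ h.map e.toEmbedding

theorem IsDecomposition.iUnion {ι : Type*} {G : ι → SimpleGraph V} {K : SimpleGraph V}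
    {𝒟 : ι → Set (Set (Sym2 V))} (h : ∀ i, IsDecomposition H (G i) (𝒟 i))
    (hdisj : ∀ i j, i ≠ j → Disjoint (G i).edgeSet (G j).edgeSet)
    (hcover : K.edgeSet = ⋃ i, (G i).edgeSet) :
    IsDecomposition H K (⋃ i, 𝒟 i) where
  isCopy E hE := by
    obtain ⟨i, hi⟩ := Set.mem_iUnion.1 hE
    exact (h i).isCopy E hi
  nonempty E hE := by
    obtain ⟨i, hi⟩ := Set.mem_iUnion.1 hE
    exact (h i).nonempty E hi
  disjoint E hE F hF hne := by
    obtain ⟨i, hi⟩ := Set.mem_iUnion.1 hE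
    obtain ⟨j, hj⟩ := Set.mem_iUnion.1 hF
    by_cases hij : i = j
    · subst hij
      exact (h i).disjoint E hi F hj hne
    · exact (hdisj i j hij).mono ((h i).subset_edgeSet hi) ((h j).subset_edgeSet hj)
  cover := by
    rw [Set.sUnion_iUnion, hcover]
    exact Set.iUnion_congr fun i => (h i).cover

theorem HasOrthogonalPair.iUnion {ι : Type*} {G : ι → SimpleGraph V} {K : SimpleGraph V}
    (h : ∀ i, HasOrthogonalPair H (G i))
    (hdisj : ∀ i j, i ≠ j → ∀ a b, (G i).Adj a b → ¬ (G j).Adj a b)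
    (hcover : ∀ a b, K.Adj a b ↔ ∃ i, (G i).Adj a b) :
    HasOrthogonalPair H K := by
  choose 𝒞 𝒟 h𝒞 h𝒟 hort using h
  have hdisj' : ∀ i j, i ≠ j → Disjoint (G i).edgeSet (G j).edgeSet := fun i j hij =>
    Set.disjoint_left.2 fun e => Sym2.ind (fun a b => hdisj i j hij a b) e
  have hcover' : K.edgeSet = ⋃ i, (G i).edgeSet := by
    ext e
    induction e with
    | h a b => simpa using hcover a b
  refine ⟨_, _, .iUnion h𝒞 hdisj' hcover', .iUnion h𝒟 hdisj' hcover', ?_⟩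
  intro E hE F hF
  obtain ⟨i, hi⟩ := Set.mem_iUnion.1 hE
  obtain ⟨j, hj⟩ := Set.mem_iUnion.1 hF
  by_cases hij : i = j
  · subst hij
    exact hort i E hi F hj
  · rw [((hdisj' i j hij).mono ((h𝒞 i).subset_edgeSet hi)
      ((h𝒟 j).subset_edgeSet hj)).inter_eq]
    simp

end Constructions

/-! ### Small orthogonal pairs, verified by finite computation -/

section ExplicitSystems

variable {ι V : Type*}

/-- The edge joining the `j`-th and the next vertex of the `i`-th closed hexagon of `c`. -/
def hexagonEdge (c : ι → Fin 6 → V) (i : ι) (j : Fin 6) : Sym2 V :=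
  s(c i j, c i (j + 1))

/-- The blocks of a family of hexagons. -/
def hexagonBlocks (c : ι → Fin 6 → V) : Set (Set (Sym2 V)) :=
  Set.range fun i => Set.range (hexagonEdge c i)

theorem cycleGraph_six_edgeSet :
    (SimpleGraph.cycleGraph 6).edgeSet = Set.range fun j : Fin 6 => s(j, j + 1) := by
  ext e
  induction e with
  | h a b =>
    rw [SimpleGraph.mem_edgeSet, Set.mem_range]
    revert a b
    decide

theorem image_cycleGraph_six_edgeSet (f : Fin 6 → V) :
    Sym2.map f '' (SimpleGraph.cycleGraph 6).edgeSet =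
      Set.range fun j : Fin 6 => s(f j, f (j + 1)) := by
  rw [cycleGraph_six_edgeSet, ← Set.range_comp]
  rfl

theorem isDecomposition_hexagonBlocks {G : SimpleGraph V} {c : ι → Fin 6 → V}
    (hinj : ∀ i, Function.Injective (c i))
    (hdisj : ∀ i i' j j', hexagonEdge c i j = hexagonEdge c i' j' → i = i')
    (hcover : ∀ a b, G.Adj a b ↔ ∃ i j, hexagonEdge c i j = s(a, b)) :
    IsDecomposition (SimpleGraph.cycleGraph 6) G (hexagonBlocks c) where
  isCopy := by
    rintro _ ⟨i, rfl⟩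
    exact ⟨⟨c i, hinj i⟩, (image_cycleGraph_six_edgeSet (c i)).symm⟩
  nonempty := by
    rintro _ ⟨i, rfl⟩
    exact Set.range_nonempty _
  disjoint := by
    rintro _ ⟨i, rfl⟩ _ ⟨i', rfl⟩ hne
    rw [Set.disjoint_left]
    rintro _ ⟨j, rfl⟩ ⟨j', hj'⟩
    exact hne (by rw [hdisj _ _ _ _ hj'])
  cover := by
    ext e
    induction e with
    | h a b => simp [hexagonBlocks, hcover]

theorem areOrthogonal_hexagonBlocks {ι' : Type*} {c : ι → Fin 6 → V} {d : ι' → Fin 6 → V}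
    (h : ∀ i i' j j', hexagonEdge c i j = hexagonEdge d i' j' →
      ∀ k k', hexagonEdge c i k = hexagonEdge d i' k' → j = k) :
    AreOrthogonal (hexagonBlocks c) (hexagonBlocks d) := by
  rintro _ ⟨i, rfl⟩ _ ⟨i', rfl⟩
  rw [Set.encard_le_one_iff]
  rintro _ _ ⟨⟨j, rfl⟩, ⟨j', hj'⟩⟩ ⟨⟨k, rfl⟩, ⟨k', hk'⟩⟩
  rw [h i i' j j' hj'.symm k k' hk'.symm]

theorem hasOrthogonalPair_top_nine :
    HasOrthogonalPair (SimpleGraph.cycleGraph 6) (⊤ : SimpleGraph (Fin 9)) := by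
  let c : Fin 6 → Fin 6 → Fin 9 :=
    ![![0, 1, 8, 2, 6, 7], ![1, 2, 4, 3, 8, 6], ![0, 5, 1, 7, 4, 6],
      ![0, 3, 6, 5, 8, 4], ![0, 2, 5, 3, 7, 8], ![1, 3, 2, 7, 5, 4]]
  let d : Fin 6 → Fin 6 → Fin 9 :=
    ![![0, 1, 5, 7, 8, 3], ![0, 4, 6, 1, 3, 7], ![2, 7, 4, 3, 5, 8],
      ![1, 4, 2, 5, 6, 7], ![0, 6, 3, 2, 1, 8], ![0, 2, 6, 8, 4, 5]]
  exact ⟨hexagonBlocks c, hexagonBlocks d,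
    isDecomposition_hexagonBlocks (by decide +kernel) (by decide +kernel) (by decide +kernel),
    isDecomposition_hexagonBlocks (by decide +kernel) (by decide +kernel) (by decide +kernel),
    areOrthogonal_hexagonBlocks (by decide +kernel)⟩

theorem hasOrthogonalPair_top_thirteen :
    HasOrthogonalPair (SimpleGraph.cycleGraph 6) (⊤ : SimpleGraph (Fin 13)) := by
  -- Both base hexagons are developed mod 13: the steps of each, up to sign, are 1, ..., 6 once
  -- each, so the translates cover every edge exactly once.
  let c : Fin 13 → Fin 6 → Fin 13 := fun i j => i + ![0, 12, 3, 8, 5, 11] j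
  let d : Fin 13 → Fin 6 → Fin 13 := fun i j => i + ![0, 3, 8, 1, 2, 4] j
  exact ⟨hexagonBlocks c, hexagonBlocks d,
    isDecomposition_hexagonBlocks (by decide +kernel) (by decide +kernel) (by decide +kernel),
    isDecomposition_hexagonBlocks (by decide +kernel) (by decide +kernel) (by decide +kernel),
    areOrthogonal_hexagonBlocks (by decide +kernel)⟩

theorem hasOrthogonalPair_completeBipartiteGraph_four_twelve :
    HasOrthogonalPair (SimpleGraph.cycleGraph 6)
      (completeBipartiteGraph (Fin 4) (Fin 12)) := by
  let l : Fin 4 → Fin 4 ⊕ Fin 12 := Sum.inl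
  let r : Fin 12 → Fin 4 ⊕ Fin 12 := Sum.inr
  let c : Fin 8 → Fin 6 → Fin 4 ⊕ Fin 12 :=
    ![![l 0, r 0, l 3, r 1, l 1, r 3], ![l 0, r 1, l 2, r 0, l 1, r 9],
      ![l 1, r 4, l 2, r 3, l 3, r 8], ![l 0, r 4, l 3, r 11, l 1, r 10],
      ![l 0, r 5, l 3, r 7, l 2, r 8], ![l 1, r 5, l 2, r 9, l 3, r 6],
      ![l 0, r 2, l 3, r 10, l 2, r 11], ![l 0, r 6, l 2, r 2, l 1, r 7]]
  let d : Fin 8 → Fin 6 → Fin 4 ⊕ Fin 12 :=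
    ![![l 0, r 2, l 2, r 9, l 1, r 4], ![l 0, r 9, l 3, r 7, l 1, r 11],
      ![l 0, r 1, l 3, r 4, l 2, r 7], ![l 1, r 2, l 3, r 5, l 2, r 3],
      ![l 0, r 3, l 3, r 10, l 1, r 6], ![l 0, r 5, l 1, r 1, l 2, r 10],
      ![l 0, r 0, l 2, r 11, l 3, r 8], ![l 1, r 0, l 3, r 6, l 2, r 8]]
  -- Adjacency is put in a form that `decide` can evaluate.
  have hadj (G : SimpleGraph (Fin 4 ⊕ Fin 12)) (hG : G = completeBipartiteGraph _ _)
      (a b : Fin 4 ⊕ Fin 12) :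
      G.Adj a b ↔ (a.isLeft ∧ b.isRight ∨ a.isRight ∧ b.isLeft) := by
    rw [hG]; rfl
  refine ⟨hexagonBlocks c, hexagonBlocks d,
    isDecomposition_hexagonBlocks (by decide +kernel) (by decide +kernel) ?_,
    isDecomposition_hexagonBlocks (by decide +kernel) (by decide +kernel) ?_,
    areOrthogonal_hexagonBlocks (by decide +kernel)⟩
  · simp only [hadj _ rfl]
    decide +kernel
  · simp only [hadj _ rfl]
    decide +kernel

theorem hasOrthogonalPair_top_of_subsingleton [Subsingleton V] {W : Type*}
    (H : SimpleGraph W) : HasOrthogonalPair H (⊤ : SimpleGraph V) := by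
  have h : IsDecomposition H (⊤ : SimpleGraph V) ∅ := by
    refine ⟨by simp, by simp, by simp, ?_⟩
    rw [Subsingleton.elim (⊤ : SimpleGraph V) ⊥]
    simp
  exact ⟨∅, ∅, h, h, by simp [AreOrthogonal]⟩

end ExplicitSystems

/-! ### The recursion from v to v + 12 -/

/-- The complete graph on `4 * m + 13` vertices is the edge-disjoint union of a complete graph on
`4 * m + 1` vertices, one on `13` vertices, and `m` copies of `K_{4,12}`. -/
theorem HasOrthogonalPair.top_sum_fin_twelve {W : Type*} {H : SimpleGraph W} {m : ℕ}
    (h13 : HasOrthogonalPair H (⊤ : SimpleGraph (Fin 13)))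
    (hbip : HasOrthogonalPair H (completeBipartiteGraph (Fin 4) (Fin 12)))
    (h : HasOrthogonalPair H (⊤ : SimpleGraph (Option (Fin m × Fin 4)))) :
    HasOrthogonalPair H (⊤ : SimpleGraph (Option (Fin m × Fin 4) ⊕ Fin 12)) := by
  let f : Option (Fin 12) ↪ Option (Fin m × Fin 4) ⊕ Fin 12 :=
    ⟨fun o => o.elim (Sum.inl none) Sum.inr, by
      rintro (_ | a) (_ | b) <;> simp [Sum.inr.injEq]⟩
  let g (i : Fin m) : Fin 4 ⊕ Fin 12 ↪ Option (Fin m × Fin 4) ⊕ Fin 12 :=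
    ⟨Sum.map (fun j => some (i, j)) id,
      Sum.map_injective.2 ⟨fun a b hab => by simpa using hab, Function.injective_id⟩⟩
  let G : Option (Option (Fin m)) → SimpleGraph (Option (Fin m × Fin 4) ⊕ Fin 12)
    | none => (⊤ : SimpleGraph (Option (Fin m × Fin 4))).map Function.Embedding.inl
    | some none => (⊤ : SimpleGraph (Option (Fin 12))).map f
    | some (some i) => (completeBipartiteGraph (Fin 4) (Fin 12)).map (g i)
  -- The unique piece containing the edge ab. The shared vertex is `Sum.inl none`; `Option.map`
  -- sends `none` to `none`, so its edges to the 12 new vertices fall in the K_13.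
  let part : Option (Fin m × Fin 4) ⊕ Fin 12 → Option (Fin m × Fin 4) ⊕ Fin 12 →
      Option (Option (Fin m))
    | .inl _, .inl _ => none
    | .inr _, .inr _ => some none
    | .inl o, .inr _ | .inr _, .inl o => some (o.map Prod.fst)
  have hf_none : f none = Sum.inl none := rfl
  have hf_some (x) : f (some x) = Sum.inr x := rfl
  have hg_inl (i j) : g i (Sum.inl j) = Sum.inl (some (i, j)) := rfl
  have hg_inr (i x) : g i (Sum.inr x) = Sum.inr x := rfl
  have hG (i) (a b) : (G i).Adj a b ↔ a ≠ b ∧ part a b = i := by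
    rcases i with _ | _ | i
    · simp only [G, SimpleGraph.map_adj]
      rcases a with a | a <;> rcases b with b | b <;> simp [part]
    · simp only [G, SimpleGraph.map_adj, Option.exists, hf_none, hf_some]
      rcases a with (_ | a) | a <;> rcases b with (_ | b) | b <;> simp [part]
    · simp only [G, SimpleGraph.map_adj, Sum.exists, hg_inl, hg_inr]
      rcases a with (_ | ⟨a, a'⟩) | a <;> rcases b with (_ | ⟨b, b'⟩) | b <;>
        simp [part, eq_comm]
  refine HasOrthogonalPair.iUnion (G := G) ?_ ?_ ?_
  · rintro (_ | _ | i)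
    · exact h.map _
    · exact (h13.top_congr (finSuccEquiv 12)).map f
    · exact hbip.map (g i)
  · intro i j hij a b hi hj
    exact hij (((hG i a b).1 hi).2.symm.trans ((hG j a b).1 hj).2)
  · simp [hG]

theorem HasOrthogonalPair.top_fin_add_twelve {v : ℕ} (hv : v % 4 = 1)
    (h : HasOrthogonalPair (SimpleGraph.cycleGraph 6) (⊤ : SimpleGraph (Fin v))) :
    HasOrthogonalPair (SimpleGraph.cycleGraph 6) (⊤ : SimpleGraph (Fin (v + 12))) := by
  obtain ⟨m, rfl⟩ : ∃ m, v = m * 4 + 1 := ⟨v / 4, by omega⟩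
  have e : Fin (m * 4 + 1) ≃ Option (Fin m × Fin 4) :=
    (finSuccEquiv _).trans (Equiv.optionCongr finProdFinEquiv.symm)
  have e' : Option (Fin m × Fin 4) ⊕ Fin 12 ≃ Fin (m * 4 + 1 + 12) :=
    (e.symm.sumCongr (Equiv.refl _)).trans finSumFinEquiv
  exact (HasOrthogonalPair.top_sum_fin_twelve hasOrthogonalPair_top_thirteen
    hasOrthogonalPair_completeBipartiteGraph_four_twelve (h.top_congr e)).top_congr e'

theorem HasOrthogonalPair.top_fin_add_twelve_mul {v : ℕ} (hv : v % 4 = 1)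
    (h : HasOrthogonalPair (SimpleGraph.cycleGraph 6) (⊤ : SimpleGraph (Fin v))) (k : ℕ) :
    HasOrthogonalPair (SimpleGraph.cycleGraph 6) (⊤ : SimpleGraph (Fin (v + 12 * k))) := by
  induction k with
  | zero => exact h
  | succ k ih => exact HasOrthogonalPair.top_fin_add_twelve (v := v + 12 * k) (by omega) ih

/-! ### Counting edges for necessity -/

section Necessity

theorem Set.dvd_ncard_sUnion_inter {α : Type*} [Finite α] {n : ℕ} {C : Set (Set α)} {S : Set α}
    (hdisj : C.PairwiseDisjoint id) (h : ∀ E ∈ C, n ∣ (E ∩ S).ncard) :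
    n ∣ (⋃₀ C ∩ S).ncard := by
  induction C, C.toFinite using Set.Finite.induction_on with
  | empty => simp
  | @insert E C hE _ ih =>
    rw [Set.sUnion_insert, Set.union_inter_distrib_right, Set.ncard_union_eq]
    · exact dvd_add (h E (Set.mem_insert _ _))
        (ih (hdisj.subset (Set.subset_insert _ _)) fun F hF => h F (Set.mem_insert_of_mem _ hF))
    · refine Disjoint.mono Set.inter_subset_left Set.inter_subset_left ?_
      rw [Set.disjoint_sUnion_right]
      exact fun F hF => hdisj (Set.mem_insert _ _) (Set.mem_insert_of_mem _ hF)
        (ne_of_mem_of_not_mem hF hE).symm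

variable {V : Type*}

/-- Blocks partition the edges, so divisibility adds up. Taking `S` to be everything counts all
edges; taking the edges at a vertex counts its degree. -/
theorem IsDecomposition.dvd_ncard_edgeSet_inter [Finite V] {W : Type*} {H : SimpleGraph W}
    {G : SimpleGraph V} {𝒟 : Set (Set (Sym2 V))} (h : IsDecomposition H G 𝒟) {n : ℕ}
    {S : Set (Sym2 V)}
    (hn : ∀ f : W ↪ V, n ∣ (Sym2.map f '' H.edgeSet ∩ S).ncard) :
    n ∣ (G.edgeSet ∩ S).ncard := by
  rw [← h.cover]
  refine Set.dvd_ncard_sUnion_inter (fun E hE F hF hne => h.disjoint E hE F hF hne) ?_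
  intro E hE
  obtain ⟨f, rfl⟩ := h.isCopy E hE
  exact hn f

theorem cycleGraph_six_ncard_edgeSet : (SimpleGraph.cycleGraph 6).edgeSet.ncard = 6 := by
  rw [cycleGraph_six_edgeSet, ← Set.image_univ, Set.ncard_image_of_injective _ (by decide)]
  simp

theorem even_ncard_hexagon_inter_incident (f : Fin 6 ↪ V) (x : V) :
    2 ∣ (Sym2.map f '' (SimpleGraph.cycleGraph 6).edgeSet ∩ {e | x ∈ e}).ncard := by
  rw [← Set.image_inter_preimage,
    Set.ncard_image_of_injective _ (Sym2.map.injective f.injective)]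
  by_cases hx : x ∈ Set.range f
  · obtain ⟨j, rfl⟩ := hx
    have hset : (SimpleGraph.cycleGraph 6).edgeSet ∩ Sym2.map f ⁻¹' {e | f j ∈ e} =
        {s(j, j + 1), s(j - 1, j)} := by
      ext e
      induction e with
      | h a b =>
        simp only [Set.mem_inter_iff, Set.mem_preimage, Sym2.map_mk, Set.mem_ofPred_eq,
          Sym2.mem_iff, f.injective.eq_iff, SimpleGraph.mem_edgeSet, Set.mem_insert_iff,
          Set.mem_singleton_iff]
        revert j a b
        decide
    rw [hset, Set.ncard_pair (by clear hset; revert j; decide)]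
  · have hset : (SimpleGraph.cycleGraph 6).edgeSet ∩ Sym2.map f ⁻¹' {e | x ∈ e} = ∅ := by
      ext e
      induction e with
      | h a b =>
        simp only [Set.mem_inter_iff, Set.mem_preimage, Sym2.map_mk, Set.mem_ofPred_eq,
          Sym2.mem_iff, Set.mem_empty_iff_false, iff_false]
        rintro ⟨-, rfl | rfl⟩ <;> simp at hx
    rw [hset, Set.ncard_empty]
    exact dvd_zero 2

theorem IsCycleSystem.six_dvd_choose {v : ℕ} {C : Set (Set (Sym2 (Fin v)))}
    (h : IsCycleSystem 6 v C) : 6 ∣ v.choose 2 := by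
  have hdvd := IsDecomposition.dvd_ncard_edgeSet_inter h (n := 6) (S := Set.univ) fun f => by
    rw [Set.inter_univ, Set.ncard_image_of_injective _ (Sym2.map.injective f.injective),
      cycleGraph_six_ncard_edgeSet]
  classical
  rwa [Set.inter_univ, ← SimpleGraph.coe_edgeFinset, Set.ncard_coe_finset,
    SimpleGraph.card_edgeFinset_top_eq_card_choose_two, Fintype.card_fin] at hdvd

theorem IsCycleSystem.even_sub_one {v : ℕ} (hv : 1 ≤ v) {C : Set (Set (Sym2 (Fin v)))}
    (h : IsCycleSystem 6 v C) : 2 ∣ v - 1 := by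
  have hdvd := IsDecomposition.dvd_ncard_edgeSet_inter h
    fun f => even_ncard_hexagon_inter_incident f ⟨0, hv⟩
  have hinc : (⊤ : SimpleGraph (Fin v)).edgeSet ∩ {e | (⟨0, hv⟩ : Fin v) ∈ e} =
      (⊤ : SimpleGraph (Fin v)).incidenceSet ⟨0, hv⟩ := rfl
  classical
  rwa [hinc, ← SimpleGraph.coe_incidenceFinset, Set.ncard_coe_finset,
    SimpleGraph.card_incidenceFinset_eq_degree, SimpleGraph.complete_graph_degree,
    Fintype.card_fin] at hdvd

end Necessity

theorem mainTheorem3 :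
    (∀ v : ℕ, v % 24 = 1 ∨ v % 24 = 9 ∨ v % 24 = 13 ∨ v % 24 = 21 →
      ∃ C₁ C₂ : Set (Set (Sym2 (Fin v))),
        IsCycleSystem 6 v C₁ ∧ IsCycleSystem 6 v C₂ ∧ AreOrthogonal C₁ C₂) ∧
    (∀ v : ℕ, 1 ≤ v → (∃ C : Set (Set (Sym2 (Fin v))), IsCycleSystem 6 v C) →
      v % 24 = 1 ∨ v % 24 = 9 ∨ v % 24 = 13 ∨ v % 24 = 21) := by
  constructor
  · intro v hv
    obtain ⟨k, rfl | rfl⟩ : ∃ k, v = 1 + 12 * k ∨ v = 9 + 12 * k := ⟨v / 12, by omega⟩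
    · exact (hasOrthogonalPair_top_of_subsingleton _).top_fin_add_twelve_mul rfl k
    · exact hasOrthogonalPair_top_nine.top_fin_add_twelve_mul rfl k
  · rintro v hv ⟨C, hC⟩
    obtain ⟨m, hm⟩ := hC.even_sub_one hv
    obtain ⟨n, hn⟩ := hC.six_dvd_choose
    obtain rfl : v = 2 * m + 1 := by omega
    rw [Nat.choose_two_right, hm, show (2 * m + 1) * (2 * m) / 2 = (2 * m + 1) * m by
      rw [mul_left_comm, Nat.mul_div_cancel_left _ two_pos]] at hn
    have hmod : ((2 * m + 1) * m) % 6 = 0 := by omega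
    have hm6 : m % 6 < 6 := Nat.mod_lt _ (by norm_num)
    rw [Nat.mul_mod, Nat.add_mod, Nat.mul_mod 2 m] at hmod
    -- Only m ≡ 0 or 4 mod 6 survive, giving v ≡ 1 or 9 mod 12.
    interval_cases hr : m % 6 <;> simp at hmod <;> omega
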